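/- Let $t\le k$ be fixed non-negative integers. For $v\ge k$, the random greedy algorithm for constructing a family of $k$-subsets (blocks) of a $v$-set that covers all $t$-subsets works as follows. (1) Fix a uniformly random ordering of all $k$-subsets of the $v$-set. (2) Choose the earliest $k$-set that contains no already covered $t$-set, where a $t$-set is covered if it is contained in a chosen $k$-set. (3) Repeat step (2) until no $k$-set can be chosen. (4) For each $t$-set that is still uncovered, add one block, an arbitrary $k$-set containing it, selected by any rule (which may depend on $v$ and on the ordering). The density of a family of blocks is the average, over all $t$-subsets of the $v$-set, of the number of blocks containing the $t$-subset. Then for every $v\ge k$ and every ordering the algorithm produces a $(v,k,t)$ covering (a family of $k$-sets such that every $t$-set is contained in at least one of them), and, for every choice of the rules in step (4), the expected density of this covering is $1+o(1)$ as $v\to\infty$. This holds both when blocks that occur repeatedly in step (4) are counted with multiplicity and when repetitions are discarded. -/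

import Mathlib

open Filter Topology
open scoped BigOperators

namespace Covering

/-- The `k`-element subsets of the `v`-set `Fin v`. -/
abbrev KSet (v k : ℕ) : Type := {K : Finset (Fin v) // K.card = k}

/-- An ordering of the `k`-sets of a `v`-set: `σ i` is the `k`-set in position `i`. -/
abbrev Ordering (v k : ℕ) : Type := Fin (v.choose k) ≃ KSet v k

/-- A family of blocks (repetitions are allowed and counted) is a `(v, k, t)` covering if all its
blocks are `k`-sets and each `t`-set is contained in at least one block. -/
def IsCovering {v : ℕ} (k t : ℕ) (B : Multiset (Finset (Fin v))) : Prop :=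
  (∀ K ∈ B, K.card = k) ∧ ∀ T : Finset (Fin v), T.card = t → ∃ K ∈ B, T ⊆ K

/-- The density of a family of blocks: the average, over all `t`-sets, of the number of blocks
containing the `t`-set. -/
noncomputable def density {v : ℕ} (t : ℕ) (B : Multiset (Finset (Fin v))) : ℝ :=
  (∑ T ∈ (Finset.univ : Finset (Fin v)).powersetCard t, (B.countP (fun K => T ⊆ K) : ℝ)) /
    (v.choose t : ℝ)

/-- The set `T` is covered by the `k`-sets whose positions lie in `S`. -/
abbrev Covered {v k : ℕ} (σ : Ordering v k) (S : Finset (Fin (v.choose k)))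
    (T : Finset (Fin v)) : Prop :=
  ∃ j ∈ S, T ⊆ (σ j).1

/-- The positions of the `k`-sets that can be chosen after those in `S`: the `k`-sets that contain
no already covered `t`-set. (When `t ≤ k`, the condition `i ∉ S` is implied by the second one.) -/
def candidates {v k : ℕ} (t : ℕ) (σ : Ordering v k) (S : Finset (Fin (v.choose k))) :
    Finset (Fin (v.choose k)) :=
  Finset.univ.filter fun i => i ∉ S ∧ ∀ T ∈ (σ i).1.powersetCard t, ¬ Covered σ S T

/-- The greedy loop, started with the `k`-sets in positions `S` already chosen: choose the
earliest possible `k`-set, and repeat until no `k`-set can be chosen. -/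
def greedyLoop {v k : ℕ} (t : ℕ) (σ : Ordering v k) (S : Finset (Fin (v.choose k))) :
    Finset (Fin (v.choose k)) :=
  if h : (candidates t σ S).Nonempty then
    greedyLoop t σ (insert ((candidates t σ S).min' h) S)
  else S
termination_by Sᶜ.card
decreasing_by
  have hm : (candidates t σ S).min' h ∉ S :=
    (Finset.mem_filter.mp ((candidates t σ S).min'_mem h)).2.1
  apply Finset.card_lt_card
  rw [Finset.compl_ssubset_compl]
  exact Finset.ssubset_insert hm

/-- The positions of the `k`-sets chosen by the greedy packing for the ordering `σ`. -/
def greedyPacking {v k : ℕ} (t : ℕ) (σ : Ordering v k) : Finset (Fin (v.choose k)) :=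
  greedyLoop t σ ∅

/-- The `t`-sets that remain uncovered by the greedy packing. -/
def remaining {v k : ℕ} (t : ℕ) (σ : Ordering v k) : Finset (Finset (Fin v)) :=
  ((Finset.univ : Finset (Fin v)).powersetCard t).filter fun T => ¬ Covered σ (greedyPacking t σ) T

/-- The output of the greedy algorithm for the ordering `σ`: the blocks of the greedy packing,
and one further block `c T` for each remaining `t`-set `T`. -/
def greedyCovering {v k : ℕ} (t : ℕ) (σ : Ordering v k) (c : Finset (Fin v) → Finset (Fin v)) :
    Multiset (Finset (Fin v)) :=
  (greedyPacking t σ).val.map (fun i => (σ i).1) + (remaining t σ).val.map c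

/-- `c` assigns to each remaining `t`-set `T` some `k`-set containing `T`. -/
def IsCoverRule {v k : ℕ} (t : ℕ) (σ : Ordering v k) (c : Finset (Fin v) → Finset (Fin v)) :
    Prop :=
  ∀ T ∈ remaining t σ, (c T).card = k ∧ T ⊆ c T

end Covering

/-!
The `k`-sets are the edges of a hypergraph whose vertices are the `t`-sets, a `k`-set containing the
vertices that are its subsets. This hypergraph is uniform with `Q = k.choose t` vertices per edge,
regular of degree `D = (v - t).choose (k - t)`, and for `0 < t < k` two vertices have at most
`(v - t - 1).choose (k - t - 1) = o(D)` common edges. The greedy packing is the greedy matching for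
the given ordering of the edges, and a double count shows that the density of the covering is
`1 + (Q - 1) * R / v.choose t`, where `R` is the number of remaining `t`-sets
(`density_greedyCovering`). So it suffices that a given vertex stays uncovered with probability
tending to `0`; for `Q = 1` there is nothing to prove. Without repetitions the density is at most
this value, and at least `1` because the family is a covering.

Let `p_r(X)` be the probability that all vertices of a set `X` are uncovered after the first `r` of
the `n` edges have been inspected. An edge all of whose vertices are uncovered has not been
inspected, and by symmetry it is equally likely to be in any of the `n - r` remaining positions.
This gives the exact hierarchy (`survivalProb_succ`)
`p_(r+1)(X) = p_r(X) - (∑ p_r(X ∪ e)) / (n - r)`, the sum being over the edges `e` meeting `X`.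
Since codegrees are small, nearly all of these edges meet `X` in a single vertex, so that `X ∪ e`
has `X.card + b` elements, where `b = Q - 1`. If `p_r(X)` depended only on the size `s` of `X`, the
hierarchy would read `a_s' = -s * a_(s+b)` in the time scale `h * r`, `h = D / n`, and it is solved
by `a_s = g ^ s`, where `g' = -g ^ (b+1)`. The lemma `abs_survivalProb_succ_sub_le` bounds how the
error `|p_r(X) - g_r ^ s|` evolves; the error at size `s` is fed by the errors at size `s + b`.
Although this recursion does not close, the trivial bound `1` on all errors controls it over a short
time, and finitely many short windows reach any fixed time (`exists_forall_err_le`). Finally `g`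
tends to `0` (`trajectory_le`), and so does the probability of staying uncovered
(`exists_survivalProb_le`).
-/

namespace Covering

/-! ### The limiting trajectory and the stability of the hierarchy -/

/-- Stability of the hierarchy. If the error at size `s` grows in one step by at most `h` times
`s * (error at size s + b) + s ^ 2 * γ`, vanishes at the start and never exceeds `1`, then for
fixed size it stays below `ε` during `i` windows of `L` steps each, once `γ` is small in terms of
`ε`, `i` and the size. Over a single window `η * φ ^ s`, with `φ` growing from `2` to at most `4`,
dominates the errors of all sizes simultaneously: large sizes because errors are at most `1`, and
small ones because of the bound from the preceding window. The recursion makes `φ` grow as in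
`φ' = φ ^ (b + 1)`, which blows up in finite time; hence the short windows and the induction on
`i`. -/
lemma exists_forall_err_le (b i : ℕ) : ∀ ε : ℝ, 0 < ε → ∀ s : ℕ, ∃ γ₀ : ℝ, 0 < γ₀ ∧
    ∀ (α : Type) (size : α → ℕ) (err : α → ℕ → ℝ) (h γ : ℝ) (L : ℕ),
      0 ≤ h → γ ≤ γ₀ → h * (4 ^ b + 1) * L ≤ 1 / 2 →
      (∀ x, err x 0 ≤ 0) → (∀ x r, err x r ≤ 1) →
      (∀ x r β, r < i * L → 0 ≤ β → (∀ y, size y = size x + b → err y r ≤ β) →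
        err x (r + 1) ≤ err x r + h * (size x * β + size x ^ 2 * γ)) →
      ∀ x r, size x ≤ s → r ≤ i * L → err x r ≤ ε := by
  induction i with
  | zero =>
    intro ε hε s
    refine ⟨1, one_pos, fun α size err h γ L _ _ _ h0 _ _ x r _ hr => ?_⟩
    obtain rfl : r = 0 := by simpa using hr
    exact (h0 x).trans hε.le
  | succ i ih =>
    intro ε hε s
    -- `φ` is at most `4`, so `η * φ ^ s ≤ ε` at the end of the window
    set η : ℝ := ε / 4 ^ s with hη
    have hη0 : 0 < η := by positivity
    have hηε : η ≤ ε := div_le_self hε.le (one_le_pow₀ (by norm_num))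
    -- from size `S` on, the dominating function exceeds the trivial bound `1`
    obtain ⟨S, hS⟩ := pow_unbounded_of_one_lt (1 / η) (one_lt_two : (1 : ℝ) < 2)
    obtain ⟨γ₀, hγ₀, H⟩ := ih η hη0 (max S s)
    refine ⟨min γ₀ η, lt_min hγ₀ hη0, fun α size err h γ L hh hγ hL h0 h1 hrec x r hx hr => ?_⟩
    have hold := H α size err h γ L hh (hγ.trans (min_le_left _ _)) hL h0 h1
      (fun x r β hr => hrec x r β (hr.trans_le (Nat.mul_le_mul_right _ (Nat.le_succ i))))
    have hγη : γ ≤ η := hγ.trans (min_le_right _ _)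
    set K : ℝ := 4 ^ b + 1 with hK
    have hK0 : 0 ≤ K := by positivity
    have hhK : 0 ≤ h * K := mul_nonneg hh hK0
    have hφ2 : ∀ ρ : ℕ, 2 ≤ 2 * (1 + h * K) ^ ρ := fun ρ => by
      have := one_le_pow₀ (n := ρ) (show (1 : ℝ) ≤ 1 + h * K by linarith)
      linarith
    have hφ4 : ∀ ρ : ℕ, ρ ≤ L → 2 * (1 + h * K) ^ ρ ≤ 4 := fun ρ hρ => by
      have e1 : (1 + h * K) ^ ρ ≤ Real.exp (1 / 2) := by
        calc (1 + h * K) ^ ρ ≤ (1 + h * K) ^ L := pow_le_pow_right₀ (by linarith) hρ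
          _ ≤ Real.exp (h * K) ^ L := by
              gcongr
              linarith [Real.add_one_le_exp (h * K)]
          _ = Real.exp (h * K * L) := by rw [← Real.exp_nat_mul, mul_comm]
          _ ≤ _ := Real.exp_le_exp.2 hL
      have e2 : Real.exp (1 / 2) ≤ 2 := by
        have h3 : Real.exp (1 / 2) * Real.exp (1 / 2) = Real.exp 1 := by
          rw [← Real.exp_add]; norm_num
        nlinarith [Real.exp_one_lt_d9, Real.exp_pos (1 / 2)]
      linarith
    have key : ∀ ρ : ℕ, ρ ≤ L → ∀ x, err x (i * L + ρ) ≤ η * (2 * (1 + h * K) ^ ρ) ^ size x := by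
      intro ρ
      induction ρ with
      | zero =>
        intro _ x
        simp only [pow_zero, mul_one, add_zero]
        by_cases hxS : size x ≤ max S s
        · exact (hold x _ hxS le_rfl).trans (le_mul_of_one_le_right hη0.le
            (one_le_pow₀ (by norm_num)))
        · have hSx : S ≤ size x := ((le_max_left S s).trans_lt (not_le.1 hxS)).le
          calc err x (i * L) ≤ η * (1 / η) := by rw [mul_one_div_cancel hη0.ne']; exact h1 _ _
            _ ≤ η * 2 ^ S := by gcongr
            _ ≤ η * 2 ^ size x := by gcongr; norm_num
      | succ ρ ihρ =>
        intro hρ x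
        have hρ' : ρ ≤ L := (Nat.le_succ ρ).trans hρ
        have h2 := hφ2 ρ
        have h4 := hφ4 ρ hρ'
        rw [pow_succ, ← mul_assoc]
        set φ : ℝ := 2 * (1 + h * K) ^ ρ with hφ
        have hr := hrec x (i * L + ρ) (η * φ ^ (size x + b))
          (by rw [Nat.succ_mul]; lia) (by positivity) (fun y hy => hy ▸ ihρ hρ' y)
        have hb : φ ^ b ≤ 4 ^ b := pow_le_pow_left₀ (by linarith) h4 b
        have hs : (size x : ℝ) ≤ φ ^ size x := by
          calc (size x : ℝ) ≤ 2 ^ size x := by exact_mod_cast Nat.lt_two_pow_self.le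
            _ ≤ φ ^ size x := by gcongr
        have hsq : (size x : ℝ) ^ 2 * γ ≤ size x * (η * φ ^ size x) := by
          calc (size x : ℝ) ^ 2 * γ ≤ (size x : ℝ) ^ 2 * η := by gcongr
            _ = size x * (η * size x) := by ring
            _ ≤ _ := by gcongr
        calc err x (i * L + (ρ + 1))
            ≤ η * φ ^ size x + h * (size x * (η * φ ^ (size x + b)) +
                size x * (η * φ ^ size x)) := by
              refine hr.trans (add_le_add (ihρ hρ' x) (mul_le_mul_of_nonneg_left ?_ hh))
              linarith
          _ = η * φ ^ size x * (1 + size x * (h * (φ ^ b + 1))) := by rw [pow_add]; ring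
          _ ≤ η * φ ^ size x * (1 + size x * (h * K)) := by
              gcongr
              linarith
          _ ≤ η * φ ^ size x * (1 + h * K) ^ size x := by
              gcongr
              exact one_add_mul_le_pow (by linarith) _
          _ = η * (φ * (1 + h * K)) ^ size x := by rw [mul_pow φ, mul_assoc]
    rcases le_total r (i * L) with hri | hri
    · exact (hold x r (hx.trans (le_max_right _ _)) hri).trans hηε
    · obtain ⟨ρ, rfl⟩ := Nat.exists_eq_add_of_le hri
      have hρ : ρ ≤ L := by rw [Nat.succ_mul] at hr; lia
      calc err x (i * L + ρ) ≤ η * (2 * (1 + h * K) ^ ρ) ^ size x := key ρ hρ x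
        _ ≤ η * 4 ^ size x := by
            gcongr
            exact hφ4 ρ hρ
        _ ≤ η * 4 ^ s := by gcongr; norm_num
        _ = ε := by rw [hη]; field_simp

/-- The predicted probability that a vertex survives `r` steps of length `h`: Euler's scheme for
the differential equation `g' = -g ^ (b + 1)`, `g 0 = 1`. -/
noncomputable def trajectory (h : ℝ) (b : ℕ) : ℕ → ℝ
  | 0 => 1
  | r + 1 => trajectory h b r * (1 - h * trajectory h b r ^ b)

lemma trajectory_mem_Icc {h : ℝ} (h0 : 0 ≤ h) (h1 : h ≤ 1) (b r : ℕ) :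
    trajectory h b r ∈ Set.Icc (0 : ℝ) 1 := by
  induction r with
  | zero => simp [trajectory]
  | succ r ih =>
    obtain ⟨hg0, hg1⟩ := ih
    have hb0 : 0 ≤ trajectory h b r ^ b := pow_nonneg hg0 b
    have hb1 : trajectory h b r ^ b ≤ 1 := pow_le_one₀ hg0 hg1
    have : h * trajectory h b r ^ b ≤ 1 := mul_le_one₀ h1 hb0 hb1
    have : 0 ≤ h * trajectory h b r ^ b := mul_nonneg h0 hb0
    exact ⟨mul_nonneg hg0 (by linarith), mul_le_one₀ hg1 (by linarith) (by linarith)⟩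

lemma one_sub_pow_le {x : ℝ} (h0 : 0 ≤ x) (h1 : x ≤ 1) (s : ℕ) :
    (1 - x) ^ s ≤ 1 - s * x + s ^ 2 * x ^ 2 := by
  induction s with
  | zero => simp
  | succ s ih =>
    have := mul_le_mul_of_nonneg_right ih (sub_nonneg.2 h1)
    rw [pow_succ]
    push_cast
    have : 0 ≤ (s : ℝ) ^ 2 * x ^ 3 := by positivity
    have : 0 ≤ ((s : ℝ) + 1) * x ^ 2 := by positivity
    nlinarith

/-- The powers of the trajectory satisfy the hierarchy `a_s' = -s * a_(s + b)`, up to an error of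
second order in the step `h`. -/
lemma abs_trajectory_succ_pow_sub_le {h : ℝ} (h0 : 0 ≤ h) (h1 : h ≤ 1) (b r s : ℕ) :
    |trajectory h b (r + 1) ^ s -
      (trajectory h b r ^ s - h * (s * trajectory h b r ^ (s + b)))| ≤ s ^ 2 * h ^ 2 := by
  obtain ⟨hg0, hg1⟩ := trajectory_mem_Icc h0 h1 b r
  rw [trajectory, mul_pow]
  set g := trajectory h b r
  have hb0 : 0 ≤ g ^ b := pow_nonneg hg0 b
  have hb1 : g ^ b ≤ 1 := pow_le_one₀ hg0 hg1
  have hx1 : h * g ^ b ≤ h := mul_le_of_le_one_right h0 hb1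
  have hx0 : 0 ≤ h * g ^ b := mul_nonneg h0 hb0
  have hs0 : 0 ≤ g ^ s := pow_nonneg hg0 s
  have hs1 : g ^ s ≤ 1 := pow_le_one₀ hg0 hg1
  have e : g ^ s * (1 - h * g ^ b) ^ s - (g ^ s - h * (s * g ^ (s + b))) =
      g ^ s * ((1 - h * g ^ b) ^ s - (1 - s * (h * g ^ b))) := by rw [pow_add]; ring
  have hl : 0 ≤ (1 - h * g ^ b) ^ s - (1 - s * (h * g ^ b)) := by
    have := one_add_mul_le_pow (show (-2 : ℝ) ≤ -(h * g ^ b) by linarith) s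
    rw [sub_nonneg]
    calc _ = 1 + s * -(h * g ^ b) := by ring
      _ ≤ _ := this
      _ = _ := by ring
  have hu := one_sub_pow_le hx0 (hx1.trans h1) s
  rw [e, abs_of_nonneg (mul_nonneg hs0 hl)]
  calc _ ≤ 1 * ((1 - h * g ^ b) ^ s - (1 - s * (h * g ^ b))) := by gcongr
    _ ≤ s ^ 2 * (h * g ^ b) ^ 2 := by linarith
    _ ≤ s ^ 2 * h ^ 2 := by gcongr

lemma trajectory_antitone {h : ℝ} (h0 : 0 ≤ h) (h1 : h ≤ 1) (b : ℕ) :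
    Antitone (trajectory h b) := by
  refine antitone_nat_of_succ_le fun r => ?_
  have hg := (trajectory_mem_Icc h0 h1 b r).1
  rw [trajectory]
  exact mul_le_of_le_one_right hg (by linarith [mul_nonneg h0 (pow_nonneg hg b)])

/-- As long as the trajectory is above `η` it decays at least by the factor
`exp (-(h * η ^ b))` per step. -/
lemma trajectory_le {h η : ℝ} (h0 : 0 ≤ h) (h1 : h ≤ 1) (hη : 0 ≤ η) (b r : ℕ)
    (hr : Real.exp (-(h * r * η ^ b)) ≤ η) : trajectory h b r ≤ η := by
  by_contra! hlt
  have key : ∀ j ≤ r, trajectory h b j ≤ Real.exp (-(h * j * η ^ b)) := by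
    intro j
    induction j with
    | zero => simp [trajectory]
    | succ j ih =>
      intro hj
      have hηj : η ≤ trajectory h b j :=
        hlt.le.trans (trajectory_antitone h0 h1 b ((Nat.le_succ j).trans hj))
      have hp : η ^ b ≤ trajectory h b j ^ b := pow_le_pow_left₀ hη hηj b
      rw [trajectory]
      calc _ ≤ trajectory h b j * Real.exp (-(h * η ^ b)) := by
            refine mul_le_mul_of_nonneg_left ?_ (hη.trans hηj)
            linarith [Real.add_one_le_exp (-(h * η ^ b)), mul_le_mul_of_nonneg_left hp h0]
        _ ≤ Real.exp (-(h * j * η ^ b)) * Real.exp (-(h * η ^ b)) := by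
            gcongr
            exact ih ((Nat.le_succ j).trans hj)
        _ = _ := by rw [← Real.exp_add]; push_cast; ring_nf
  exact absurd ((key r le_rfl).trans hr) (not_le.2 hlt)

/-! ### Survival probabilities of the random greedy matching -/

section Hierarchy

variable {α E : Type} {n : ℕ}

/-- `M` is the set of positions of the edges chosen by the greedy matching algorithm which goes
through the edges in the order `σ`: an edge is chosen exactly when it is disjoint from all edges
chosen earlier. -/
def IsGreedy (inc : E → Finset α) (σ : Fin n ≃ E) (M : Finset (Fin n)) : Prop :=
  ∀ i, i ∈ M ↔ ∀ j ∈ M, j < i → Disjoint (inc (σ i)) (inc (σ j))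

/-- No vertex of `X` is covered by an edge of `M` among the first `r` positions. -/
def Survives (inc : E → Finset α) (σ : Fin n ≃ E) (M : Finset (Fin n)) (r : ℕ)
    (X : Finset α) : Prop :=
  ∀ j ∈ M, (j : ℕ) < r → Disjoint X (inc (σ j))

lemma IsGreedy.mem_congr {inc : E → Finset α} {σ σ' : Fin n ≃ E} {M M' : Finset (Fin n)}
    (hM : IsGreedy inc σ M) (hM' : IsGreedy inc σ' M') {r : ℕ}
    (h : ∀ i : Fin n, (i : ℕ) < r → σ i = σ' i) (i : Fin n) (hi : (i : ℕ) < r) :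
    i ∈ M ↔ i ∈ M' := by
  induction i using WellFoundedLT.induction with
  | ind i ih =>
    rw [hM i, hM' i, h i hi]
    refine forall_congr' fun j => ⟨fun H hj hji => ?_, fun H hj hji => ?_⟩
    · have hjr : (j : ℕ) < r := lt_trans hji hi
      rw [← h j hjr]
      exact H ((ih j hji hjr).2 hj) hji
    · have hjr : (j : ℕ) < r := lt_trans hji hi
      rw [h j hjr]
      exact H ((ih j hji hjr).1 hj) hji

lemma IsGreedy.survives_congr {inc : E → Finset α} {σ σ' : Fin n ≃ E} {M M' : Finset (Fin n)}
    (hM : IsGreedy inc σ M) (hM' : IsGreedy inc σ' M') {r : ℕ}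
    (h : ∀ i : Fin n, (i : ℕ) < r → σ i = σ' i) (X : Finset α) :
    Survives inc σ M r X ↔ Survives inc σ' M' r X := by
  refine forall_congr' fun j => ⟨fun H hj hjr => ?_, fun H hj hjr => ?_⟩
  · rw [← h j hjr]
    exact H ((hM.mem_congr hM' h j hjr).2 hj) hjr
  · rw [h j hjr]
    exact H ((hM.mem_congr hM' h j hjr).1 hj) hjr

/-- An edge that has been inspected is no longer entirely uncovered: it was either chosen or
blocked. -/
lemma IsGreedy.not_survives_of_lt {inc : E → Finset α} {σ : Fin n ≃ E} {M : Finset (Fin n)}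
    (hM : IsGreedy inc σ M) (hne : ∀ e, (inc e).Nonempty) {r : ℕ} {i : Fin n}
    (hi : (i : ℕ) < r) : ¬ Survives inc σ M r (inc (σ i)) := by
  intro H
  have hiM : i ∈ M := (hM i).2 fun j hj hji => H j hj (lt_trans hji hi)
  exact (hne (σ i)).ne_empty (disjoint_self.1 (H i hiM hi))

lemma IsGreedy.survives_succ_iff {inc : E → Finset α} {σ : Fin n ≃ E} {M : Finset (Fin n)}
    (hM : IsGreedy inc σ M) (r : Fin n) (X : Finset α) :
    Survives inc σ M (r + 1) X ↔ Survives inc σ M r X ∧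
      ¬ (¬ Disjoint X (inc (σ r)) ∧ Survives inc σ M r (inc (σ r))) := by
  constructor
  · intro H
    refine ⟨fun j hj hjr => H j hj (Nat.lt_succ_of_lt hjr), fun ⟨h1, h2⟩ => h1 ?_⟩
    exact H r ((hM r).2 h2) (Nat.lt_succ_self _)
  · rintro ⟨h1, h2⟩ j hj hjr
    rcases Nat.lt_succ_iff_lt_or_eq.1 hjr with h | h
    · exact h1 j hj h
    · obtain rfl : j = r := Fin.ext h
      by_contra hd
      exact h2 ⟨hd, (hM j).1 hj⟩

lemma survives_union [DecidableEq α] {inc : E → Finset α} {σ : Fin n ≃ E}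
    {M : Finset (Fin n)} {r : ℕ} {X Y : Finset α} :
    Survives inc σ M r (X ∪ Y) ↔ Survives inc σ M r X ∧ Survives inc σ M r Y := by
  simp only [Survives, Finset.disjoint_union_left, ← forall_and]

variable [Fintype E] [DecidableEq E]

open Classical in
/-- The probability, for a uniformly random ordering `σ` of the edges, that the vertices of `X` are
all uncovered after `r` steps; `M σ` stands for the greedy matching of the ordering `σ`. -/
noncomputable def survivalProb (inc : E → Finset α) (M : (Fin n ≃ E) → Finset (Fin n)) (r : ℕ)
    (X : Finset α) : ℝ :=
  𝔼 σ : Fin n ≃ E, if Survives inc σ (M σ) r X then 1 else 0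

variable {inc : E → Finset α} {M : (Fin n ≃ E) → Finset (Fin n)}

lemma survivalProb_nonneg (r : ℕ) (X : Finset α) : 0 ≤ survivalProb inc M r X :=
  Finset.expect_nonneg fun σ _ => by split_ifs <;> norm_num

lemma survivalProb_le_one [Nonempty (Fin n ≃ E)] (r : ℕ) (X : Finset α) :
    survivalProb inc M r X ≤ 1 :=
  Finset.expect_le Finset.univ_nonempty fun σ _ => by split_ifs <;> norm_num

lemma survivalProb_zero [Nonempty (Fin n ≃ E)] (X : Finset α) : survivalProb inc M 0 X = 1 := by
  simp [survivalProb, Survives]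

variable [DecidableEq α]

open Classical in
/-- If all vertices of `e` are uncovered after `r` steps, then `e` has not been inspected yet, and
it is equally likely to sit in any of the `n - r` remaining positions. -/
lemma expect_at_position (hM : ∀ σ, IsGreedy inc σ (M σ)) (hne : ∀ e, (inc e).Nonempty)
    (r : Fin n) (X : Finset α) (e : E) :
    𝔼 σ : Fin n ≃ E, (if σ r = e ∧ Survives inc σ (M σ) r (X ∪ inc e) then (1 : ℝ) else 0) =
      survivalProb inc M r (X ∪ inc e) / ((n : ℝ) - r) := by
  have hrn : (0 : ℝ) < (n : ℝ) - r := sub_pos.2 (by exact_mod_cast r.2)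
  -- exchanging two positions that are not before `r` does not change the first `r` steps
  have hswap : ∀ i ∈ Finset.Ici r,
      𝔼 σ : Fin n ≃ E, (if σ i = e ∧ Survives inc σ (M σ) r (X ∪ inc e) then (1 : ℝ) else 0) =
      𝔼 σ : Fin n ≃ E, (if σ r = e ∧ Survives inc σ (M σ) r (X ∪ inc e) then (1 : ℝ) else 0) := by
    intro i hi
    refine Fintype.expect_equiv (Equiv.equivCongr (Equiv.swap r i) (Equiv.refl E)) _ _ fun σ => ?_
    set σ' := Equiv.equivCongr (Equiv.swap r i) (Equiv.refl E) σ with hσ'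
    have happ : ∀ j, σ' j = σ (Equiv.swap r i j) := fun j => by simp [hσ', Equiv.equivCongr]
    have hs : Survives inc σ (M σ) r (X ∪ inc e) ↔ Survives inc σ' (M σ') r (X ∪ inc e) := by
      refine (hM σ).survives_congr (hM σ') (fun j hj => ?_) _
      have hri : r ≤ i := Finset.mem_Ici.1 hi
      have hjr : j < r := hj
      rw [happ, Equiv.swap_apply_of_ne_of_ne hjr.ne (hjr.trans_le hri).ne]
    rw [happ, Equiv.swap_apply_left, hs]
  have hsum : ∑ i ∈ Finset.Ici r,
      𝔼 σ : Fin n ≃ E, (if σ i = e ∧ Survives inc σ (M σ) r (X ∪ inc e) then (1 : ℝ) else 0) =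
      survivalProb inc M r (X ∪ inc e) := by
    rw [← Finset.expect_sum_comm, survivalProb]
    refine Finset.expect_congr rfl fun σ _ => ?_
    split_ifs with hS
    · have hpos : r ≤ σ.symm e := by
        by_contra! hlt
        refine (hM σ).not_survives_of_lt hne (i := σ.symm e) hlt ?_
        rw [σ.apply_symm_apply]
        exact (survives_union.1 hS).2
      rw [Finset.sum_eq_single_of_mem (σ.symm e) (Finset.mem_Ici.2 hpos)]
      · simp [hS]
      · intro i _ hi
        rw [if_neg]
        rintro ⟨rfl, _⟩
        simp at hi
    · simp [hS]
  rw [Finset.sum_congr rfl hswap, Finset.sum_const, nsmul_eq_mul, Fin.card_Ici,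
    Nat.cast_sub r.2.le] at hsum
  rw [eq_div_iff hrn.ne', mul_comm, hsum]

open Classical in
/-- The exact hierarchy of equations satisfied by the survival probabilities: if the vertices of `X`
survive step `r` but not step `r + 1`, then the edge `e` in position `r` meets `X` and is chosen, so
all of `X ∪ e` is uncovered after `r` steps. -/
lemma survivalProb_succ (hM : ∀ σ, IsGreedy inc σ (M σ)) (hne : ∀ e, (inc e).Nonempty)
    (r : Fin n) (X : Finset α) :
    survivalProb inc M (r + 1) X = survivalProb inc M r X -
      (∑ e, if Disjoint X (inc e) then 0 else survivalProb inc M r (X ∪ inc e)) /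
        ((n : ℝ) - r) := by
  have hstep : ∀ σ : Fin n ≃ E, (if Survives inc σ (M σ) (r + 1) X then (1 : ℝ) else 0) =
      (if Survives inc σ (M σ) r X then 1 else 0) - ∑ e, if Disjoint X (inc e) then 0 else
        if σ r = e ∧ Survives inc σ (M σ) r (X ∪ inc e) then 1 else 0 := by
    intro σ
    rw [Finset.sum_eq_single (σ r) (fun e _ he => by simp [he.symm]) (by simp)]
    simp only [(hM σ).survives_succ_iff, survives_union]
    split_ifs <;> simp_all
  rw [survivalProb, Finset.expect_congr rfl fun σ _ => hstep σ, Finset.expect_sub_distrib,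
    Finset.expect_sum_comm, Finset.sum_div]
  congr 1
  refine Finset.sum_congr rfl fun e _ => ?_
  split_ifs with hd
  · simp
  · exact expect_at_position hM hne r X e

end Hierarchy

/-! ### Comparison with the trajectory -/

section Hypergraph

variable {α E : Type} [DecidableEq α] [Fintype E]

lemma sum_card_inter_eq {inc : E → Finset α} {D : ℕ}
    (hdeg : ∀ x, (Finset.univ.filter fun e => x ∈ inc e).card = D) (X : Finset α) :
    ∑ e, ((X ∩ inc e).card : ℝ) = X.card * D := by
  have : ∀ e, ((X ∩ inc e).card : ℝ) = ∑ x ∈ X, if x ∈ inc e then (1 : ℝ) else 0 := fun e => by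
    rw [Finset.sum_boole, Finset.filter_mem_eq_inter]
  simp_rw [this]
  rw [Finset.sum_comm]
  simp [hdeg]

/-- In a hypergraph with small codegrees few edges meet `X` in two or more vertices. -/
lemma sum_card_inter_mul_le {inc : E → Finset α} {D : ℕ} {c : ℝ} (hc : 0 ≤ c)
    (hdeg : ∀ x, (Finset.univ.filter fun e => x ∈ inc e).card = D)
    (hcodeg : ∀ x y, x ≠ y →
      ((Finset.univ.filter fun e => x ∈ inc e ∧ y ∈ inc e).card : ℝ) ≤ c) (X : Finset α) :
    ∑ e, ((X ∩ inc e).card : ℝ) * ((X ∩ inc e).card - 1) ≤ X.card ^ 2 * c := by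
  have hcard : ∀ e, ((X ∩ inc e).card : ℝ) = ∑ x ∈ X, if x ∈ inc e then (1 : ℝ) else 0 :=
    fun e => by rw [Finset.sum_boole, Finset.filter_mem_eq_inter]
  have hsq : ∑ e, ((X ∩ inc e).card : ℝ) * (X ∩ inc e).card =
      ∑ x ∈ X, ∑ y ∈ X, ((Finset.univ.filter fun e => x ∈ inc e ∧ y ∈ inc e).card : ℝ) := by
    simp_rw [hcard, Finset.sum_mul_sum]
    rw [Finset.sum_comm]
    refine Finset.sum_congr rfl fun x _ => ?_
    rw [Finset.sum_comm]
    refine Finset.sum_congr rfl fun y _ => ?_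
    rw [← Finset.sum_boole]
    exact Finset.sum_congr rfl fun e _ => by split_ifs <;> simp_all
  have hle : ∀ x ∈ X, ∑ y ∈ X,
      ((Finset.univ.filter fun e => x ∈ inc e ∧ y ∈ inc e).card : ℝ) ≤ D + X.card * c := by
    intro x hx
    calc _ ≤ ∑ y ∈ X, ((if x = y then (D : ℝ) else 0) + c) := by
          refine Finset.sum_le_sum fun y _ => ?_
          split_ifs with h
          · subst h
            simp only [and_self, hdeg]
            linarith
          · rw [zero_add]
            exact hcodeg x y h
      _ = _ := by simp [Finset.sum_add_distrib, hx]
  have hsum := Finset.sum_le_sum hle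
  rw [Finset.sum_const, nsmul_eq_mul] at hsum
  simp_rw [mul_sub, mul_one, Finset.sum_sub_distrib]
  rw [hsq, sum_card_inter_eq hdeg]
  linarith

/-- If `f` is within `β` of `G` on sets of size `X.card + b`, then the sum in the hierarchy is close
to its ideal value `X.card * D * G`. Edges meeting `X` in exactly one vertex contribute the error
`β`, and the others are few. -/
lemma abs_sum_sub_le {inc : E → Finset α} {b D : ℕ} {c β G : ℝ} {f : Finset α → ℝ} (hc : 0 ≤ c)
    (hβ : 0 ≤ β) (hG0 : 0 ≤ G) (hG1 : G ≤ 1) (hf0 : ∀ Y, 0 ≤ f Y) (hf1 : ∀ Y, f Y ≤ 1)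
    (hcard : ∀ e, (inc e).card = b + 1)
    (hdeg : ∀ x, (Finset.univ.filter fun e => x ∈ inc e).card = D)
    (hcodeg : ∀ x y, x ≠ y →
      ((Finset.univ.filter fun e => x ∈ inc e ∧ y ∈ inc e).card : ℝ) ≤ c) (X : Finset α)
    (hX : ∀ Y : Finset α, Y.card = X.card + b → |f Y - G| ≤ β) :
    |(∑ e, if Disjoint X (inc e) then 0 else f (X ∪ inc e)) - X.card * D * G| ≤
      X.card * D * β + X.card ^ 2 * c := by
  rw [← sum_card_inter_eq hdeg, Finset.sum_mul, Finset.sum_mul, ← Finset.sum_sub_distrib]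
  refine (Finset.abs_sum_le_sum_abs _ _).trans
    (le_trans ?_ (add_le_add_right (sum_card_inter_mul_le hc hdeg hcodeg X) _))
  rw [← Finset.sum_add_distrib]
  refine Finset.sum_le_sum fun e _ => ?_
  have hd : Disjoint X (inc e) ↔ (X ∩ inc e).card = 0 := by
    rw [Finset.disjoint_iff_inter_eq_empty, Finset.card_eq_zero]
  simp only [hd]
  have hun := Finset.card_union_add_card_inter X (inc e)
  rw [hcard] at hun
  generalize hi : (X ∩ inc e).card = i at *
  rcases i with - | - | i
  · simp
  · have := hX (X ∪ inc e) (by lia)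
    simpa using this
  · rw [if_neg (by lia)]
    have h0 := hf0 (X ∪ inc e)
    have h1 := hf1 (X ∪ inc e)
    push_cast
    have hi0 : (0 : ℝ) ≤ i := Nat.cast_nonneg i
    have : 0 ≤ ((i : ℝ) + 1 + 1) * β := by positivity
    rw [abs_le]
    constructor <;> nlinarith

/-- One step of the error recursion between the survival probabilities and the powers of the
trajectory with step `D / n`. The three parts of the defect are due to the edges being drawn without
replacement (`κ`), to codegrees (`δ`) and to discretization (`D / n`). -/
lemma abs_survivalProb_succ_sub_le [DecidableEq E] {n b D : ℕ} {inc : E → Finset α}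
    {M : (Fin n ≃ E) → Finset (Fin n)} {δ κ β : ℝ} [Nonempty (Fin n ≃ E)]
    (hM : ∀ σ, IsGreedy inc σ (M σ)) (hδ : 0 ≤ δ)
    (hcard : ∀ e, (inc e).card = b + 1)
    (hdeg : ∀ x, (Finset.univ.filter fun e => x ∈ inc e).card = D)
    (hcodeg : ∀ x y, x ≠ y →
      ((Finset.univ.filter fun e => x ∈ inc e ∧ y ∈ inc e).card : ℝ) ≤ δ * D)
    (hDn : (D : ℝ) / n ≤ 1) (r : Fin n) (hr : (r : ℝ) ≤ κ * ((n : ℝ) - r)) (hβ : 0 ≤ β)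
    (X : Finset α)
    (hX : ∀ Y : Finset α, Y.card = X.card + b →
      |survivalProb inc M r Y - trajectory ((D : ℝ) / n) b r ^ Y.card| ≤ β) :
    |survivalProb inc M (r + 1) X - trajectory ((D : ℝ) / n) b (r + 1) ^ X.card| ≤
      |survivalProb inc M r X - trajectory ((D : ℝ) / n) b r ^ X.card| +
        (D : ℝ) / n * (X.card * β + X.card ^ 2 * (κ + δ + (D : ℝ) / n)) := by
  have hn : (0 : ℝ) < n := by exact_mod_cast (Nat.zero_le _).trans_lt r.2
  have hrn : (0 : ℝ) < (n : ℝ) - r := sub_pos.2 (by exact_mod_cast r.2)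
  have hne : ∀ e, (inc e).Nonempty := fun e => Finset.card_pos.1 (by rw [hcard]; lia)
  rw [survivalProb_succ hM hne]
  have hh0 : 0 ≤ (D : ℝ) / n := by positivity
  have htr := abs_trajectory_succ_pow_sub_le hh0 hDn b r X.card
  obtain ⟨hg0, hg1⟩ := trajectory_mem_Icc hh0 hDn b r
  set g := trajectory ((D : ℝ) / n) b r
  have hsum := abs_sum_sub_le (f := survivalProb inc M r) (G := g ^ (X.card + b))
    (mul_nonneg hδ (Nat.cast_nonneg D)) hβ (pow_nonneg hg0 _) (pow_le_one₀ hg0 hg1)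
    (survivalProb_nonneg r) (survivalProb_le_one r) hcard hdeg hcodeg X
    (fun Y hY => by rw [← hY]; exact hX Y hY)
  have hS0 : 0 ≤ ∑ e, if Disjoint X (inc e) then 0 else survivalProb inc M r (X ∪ inc e) :=
    Finset.sum_nonneg fun e _ => by
      split_ifs
      · exact le_rfl
      · exact survivalProb_nonneg _ _
  have hS1 : (∑ e, if Disjoint X (inc e) then 0 else survivalProb inc M r (X ∪ inc e)) ≤
      X.card * D := by
    rw [← sum_card_inter_eq hdeg]
    refine Finset.sum_le_sum fun e _ => ?_
    split_ifs with hd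
    · positivity
    · refine (survivalProb_le_one _ _).trans ?_
      rw [Finset.not_disjoint_iff_nonempty_inter, ← Finset.card_pos] at hd
      exact_mod_cast hd
  set S := ∑ e, if Disjoint X (inc e) then 0 else survivalProb inc M r (X ∪ inc e)
  set s : ℝ := (X.card : ℝ) with hs
  have hs0 : 0 ≤ s := Nat.cast_nonneg _
  have hss : s ≤ s ^ 2 := by rw [hs]; exact_mod_cast Nat.le_self_pow two_ne_zero _
  -- the edge in position `r` is uniform among `n - r` edges rather than `n`
  have hA : |S / ((n : ℝ) - r) - S / n| ≤ (D : ℝ) / n * (s ^ 2 * κ) := by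
    have hκ : (r : ℝ) / ((n : ℝ) - r) ≤ κ := (div_le_iff₀ hrn).2 hr
    have hκ0 : 0 ≤ (r : ℝ) / ((n : ℝ) - r) := by positivity
    have e : S / ((n : ℝ) - r) - S / n = S / n * (r / ((n : ℝ) - r)) := by
      field_simp
      ring
    rw [e, abs_of_nonneg (by positivity)]
    calc S / n * (r / ((n : ℝ) - r)) ≤ s * D / n * κ := by gcongr
      _ = (D : ℝ) / n * (s * κ) := by ring
      _ ≤ (D : ℝ) / n * (s ^ 2 * κ) := by
          have := hκ0.trans hκ
          gcongr
  have hB : |S / n - (D : ℝ) / n * (s * g ^ (X.card + b))| ≤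
      (D : ℝ) / n * (s * β + s ^ 2 * δ) := by
    have e : S / n - (D : ℝ) / n * (s * g ^ (X.card + b)) =
        (S - s * D * g ^ (X.card + b)) / n := by
      field_simp
    rw [e, abs_div, abs_of_pos hn, div_le_iff₀ hn]
    refine hsum.trans_eq ?_
    field_simp
  have hC : s ^ 2 * ((D : ℝ) / n) ^ 2 = (D : ℝ) / n * (s ^ 2 * ((D : ℝ) / n)) := by ring
  rw [hC] at htr
  set h := (D : ℝ) / n
  rw [abs_le] at hA hB htr
  have h1 := neg_abs_le (survivalProb inc M r X - g ^ X.card)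
  have h2 := le_abs_self (survivalProb inc M r X - g ^ X.card)
  have e1 : h * (s * β + s ^ 2 * (κ + δ + h)) =
    h * (s ^ 2 * κ) + h * (s * β + s ^ 2 * δ) + h * (s ^ 2 * h) := by ring
  rw [e1, abs_le]
  constructor <;> linarith [hA.1, hA.2, hB.1, hB.2, htr.1, htr.2]

end Hypergraph

/-- For uniform regular hypergraphs with small codegrees, the random greedy matching leaves any
given vertex uncovered with small probability; this happens already after some number `r` of
steps. The hypothesis `D ≤ δ * n` says that a single step covers a small proportion of the
vertices. -/
theorem exists_survivalProb_le (b : ℕ) {ε : ℝ} (hε : 0 < ε) : ∃ δ : ℝ, 0 < δ ∧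
    ∀ (α E : Type) [DecidableEq α] [Fintype E] [DecidableEq E] (n D : ℕ) (inc : E → Finset α)
      (M : (Fin n ≃ E) → Finset (Fin n)), Nonempty (Fin n ≃ E) →
      (∀ σ, IsGreedy inc σ (M σ)) →
      (∀ e, (inc e).card = b + 1) →
      (∀ x, (Finset.univ.filter fun e => x ∈ inc e).card = D) →
      (∀ x y, x ≠ y → ((Finset.univ.filter fun e => x ∈ inc e ∧ y ∈ inc e).card : ℝ) ≤ δ * D) →
      1 ≤ δ * D → (D : ℝ) ≤ δ * n →
      ∃ r, ∀ x, survivalProb inc M r {x} ≤ ε := by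
  set K : ℝ := 4 ^ b + 1 with hK
  have hK1 : 1 ≤ K := by rw [hK]; linarith [show (0 : ℝ) < 4 ^ b by positivity]
  have hK0 : 0 < K := by linarith
  set η : ℝ := ε / 2 with hη
  have hη0 : 0 < η := by positivity
  -- after time `i / (4 * K)` the trajectory is below `η`
  obtain ⟨i, hi⟩ : ∃ i : ℕ, Real.exp (-(i / (4 * K) * η ^ b)) ≤ η := by
    have : Tendsto (fun i : ℕ => Real.exp (-(i / (4 * K) * η ^ b))) atTop (𝓝 0) := by
      refine Real.tendsto_exp_neg_atTop_nhds_zero.comp ?_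
      refine Tendsto.atTop_mul_const (by positivity) ?_
      exact tendsto_natCast_atTop_atTop.atTop_div_const (by positivity)
    exact (this.eventually_le_const hη0).exists
  obtain ⟨γ₀, hγ₀, H⟩ := exists_forall_err_le b i η hη0 1
  -- the bounds on `δ` ensure, in turn, that the defect `2 * i * δ + δ + h` is at most `γ₀`, that
  -- at most half of the positions are used, and that a window has duration at least `1 / (4 * K)`
  refine ⟨min (γ₀ / (2 * i + 2)) (min (1 / (2 * i + 2)) (1 / (4 * K))), by positivity, ?_⟩
  set δ : ℝ := min (γ₀ / (2 * i + 2)) (min (1 / (2 * i + 2)) (1 / (4 * K))) with hδ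
  have hδ0 : 0 < δ := by positivity
  have hδ1 : (2 * i + 2) * δ ≤ γ₀ := by
    rw [mul_comm, ← le_div_iff₀ (by positivity)]
    exact min_le_left _ _
  have hδ2 : (2 * i + 2) * δ ≤ 1 := by
    rw [mul_comm, ← le_div_iff₀ (by positivity)]
    exact (min_le_right _ _).trans (min_le_left _ _)
  have hδ3 : δ * (4 * K) ≤ 1 := by
    rw [← le_div_iff₀ (by positivity)]
    exact (min_le_right _ _).trans (min_le_right _ _)
  intro α E _ _ _ n D inc M hne hM hcard hdeg hcodeg hD hDn
  have hD0 : (0 : ℝ) < D := by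
    by_contra! h
    nlinarith
  have hn0 : (0 : ℝ) < n := by
    by_contra! h
    nlinarith
  set h : ℝ := (D : ℝ) / n with hh
  have hh0 : 0 < h := by positivity
  have hhδ : h ≤ δ := (div_le_iff₀ hn0).2 hDn
  have hi0 : (0 : ℝ) ≤ i := Nat.cast_nonneg i
  have hh1 : h ≤ 1 := by nlinarith
  have hhK : 0 < h * K := by positivity
  set L : ℕ := ⌊1 / 2 / (h * K)⌋₊ with hL
  have hLle : h * K * L ≤ 1 / 2 := by
    rw [mul_comm, ← le_div_iff₀ hhK]
    exact Nat.floor_le (by positivity)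
  have hLge : 1 / 4 ≤ h * K * L := by
    have h1 : 1 / 2 / (h * K) < L + 1 := Nat.lt_floor_add_one _
    rw [div_lt_iff₀ hhK] at h1
    nlinarith
  -- the number of steps is small compared with `n`
  have hcount : ((i * L : ℕ) : ℝ) ≤ i * δ * n := by
    have h1 : h * L ≤ 1 := by nlinarith [mul_nonneg hh0.le (Nat.cast_nonneg (α := ℝ) L)]
    have h2 : (L : ℝ) ≤ n / D := by
      rw [le_div_iff₀ hD0]
      calc (L : ℝ) * D = h * L * n := by rw [hh]; field_simp
        _ ≤ 1 * n := by gcongr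
        _ = n := one_mul _
    have h3 : (n : ℝ) / D ≤ δ * n := by
      rw [div_le_iff₀ hD0]
      nlinarith
    push_cast
    rw [mul_assoc]
    exact mul_le_mul_of_nonneg_left (h2.trans h3) hi0
  refine ⟨i * L, fun x => ?_⟩
  have herr := H (Finset α) Finset.card
    (fun X r => |survivalProb inc M r X - trajectory h b r ^ X.card|) h ((2 * i + 2) * δ) L
    hh0.le hδ1 hLle (fun X => by simp [survivalProb_zero, trajectory])
    (fun X r => by
      obtain ⟨hg0, hg1⟩ := trajectory_mem_Icc hh0.le hh1 b r
      have hp0 := pow_nonneg hg0 X.card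
      have hp1 := pow_le_one₀ (n := X.card) hg0 hg1
      have hq0 := survivalProb_nonneg (inc := inc) (M := M) r X
      have hq1 := survivalProb_le_one (inc := inc) (M := M) r X
      rw [abs_le]
      constructor <;> linarith)
    (fun X r β hr hβ hX => by
      have hrL : (r : ℝ) ≤ i * δ * n := le_trans (by exact_mod_cast hr.le) hcount
      have hrn2 : (r : ℝ) ≤ n / 2 := by nlinarith
      have hrn : r < n := by
        have : (r : ℝ) < n := by linarith
        exact_mod_cast this
      have hstep := abs_survivalProb_succ_sub_le (κ := 2 * i * δ) hM hδ0.le hcard hdeg hcodeg hh1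
        ⟨r, hrn⟩ (by
          have h1 : 2 * i * δ * (n / 2) ≤ 2 * i * δ * ((n : ℝ) - r) :=
            mul_le_mul_of_nonneg_left (by linarith) (by positivity)
          exact le_trans (by linarith) h1) hβ X hX
      refine hstep.trans (add_le_add_right (mul_le_mul_of_nonneg_left ?_ hh0.le) _)
      refine add_le_add_right (mul_le_mul_of_nonneg_left ?_ (by positivity)) _
      rw [← hh]
      linarith)
    {x} (i * L) (by simp) le_rfl
  have htraj : trajectory h b (i * L) ≤ η := by
    refine trajectory_le hh0.le hh1 hη0.le b _ (le_trans (Real.exp_le_exp.2 ?_) hi)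
    rw [neg_le_neg_iff]
    refine mul_le_mul_of_nonneg_right ?_ (by positivity)
    rw [div_le_iff₀ (by positivity)]
    push_cast
    nlinarith
  rw [Finset.card_singleton, pow_one] at herr
  have := (abs_le.1 herr).2
  linarith

/-! ### The hypergraph of blocks and the density of the covering -/

section Packing

variable {v k : ℕ}

/-- The edge of the hypergraph on the `t`-subsets that corresponds to the `k`-set `K`: all
`t`-subsets of `K`. In this hypergraph a packing of `k`-sets is a matching. -/
def tSubsets (t : ℕ) (K : KSet v k) : Finset {T : Finset (Fin v) // T.card = t} :=
  Finset.univ.filter fun T => T.1 ⊆ K.1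

@[simp] lemma mem_tSubsets {t : ℕ} {K : KSet v k} {T : {T : Finset (Fin v) // T.card = t}} :
    T ∈ tSubsets t K ↔ T.1 ⊆ K.1 := by
  simp [tSubsets]

lemma map_tSubsets (t : ℕ) (K : KSet v k) :
    (tSubsets t K).map (Function.Embedding.subtype _) = K.1.powersetCard t := by
  ext T
  simp [Finset.mem_powersetCard, and_comm]

lemma card_tSubsets (t : ℕ) (K : KSet v k) : (tSubsets t K).card = k.choose t := by
  rw [← Finset.card_map (Function.Embedding.subtype _), map_tSubsets, Finset.card_powersetCard,
    K.2]

lemma disjoint_tSubsets {t : ℕ} {K L : KSet v k} :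
    Disjoint (tSubsets t K) (tSubsets t L) ↔
      Disjoint (K.1.powersetCard t) (L.1.powersetCard t) := by
  rw [← map_tSubsets, ← map_tSubsets, Finset.disjoint_map]

lemma mem_candidates {t : ℕ} {σ : Ordering v k} {S : Finset (Fin (v.choose k))}
    {i : Fin (v.choose k)} :
    i ∈ candidates t σ S ↔ i ∉ S ∧ ∀ j ∈ S, Disjoint (tSubsets t (σ i)) (tSubsets t (σ j)) := by
  simp only [candidates, Covered, Finset.mem_filter, Finset.mem_univ, true_and,
    disjoint_tSubsets]
  simp only [Finset.disjoint_left, Finset.mem_powersetCard]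
  grind

/-- The loop preserves the two invariants that the chosen blocks share no `t`-set, and that each
block which is not chosen is either still a candidate or blocked by an earlier chosen block. When
no candidate is left, they characterize the greedy matching. -/
lemma isGreedy_greedyLoop (t : ℕ) (σ : Ordering v k) (S : Finset (Fin (v.choose k)))
    (hdisj : ∀ i ∈ S, ∀ j ∈ S, j ≠ i → Disjoint (tSubsets t (σ i)) (tSubsets t (σ j)))
    (hout : ∀ i ∉ S, i ∈ candidates t σ S ∨
      ∃ j ∈ S, j < i ∧ ¬ Disjoint (tSubsets t (σ i)) (tSubsets t (σ j))) :
    IsGreedy (tSubsets t) σ (greedyLoop t σ S) := by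
  induction S using greedyLoop.induct t σ with
  | case1 S h ih =>
    rw [greedyLoop, dif_pos h]
    have hm := (mem_candidates.1 ((candidates t σ S).min'_mem h)).2
    apply ih
    · intro i hi j hj hji
      rcases Finset.mem_insert.1 hi with rfl | hi <;> rcases Finset.mem_insert.1 hj with rfl | hj
      · exact absurd rfl hji
      · exact hm j hj
      · exact (hm i hi).symm
      · exact hdisj i hi j hj hji
    · intro i hi
      obtain ⟨him, hiS⟩ : i ≠ _ ∧ i ∉ S := by simpa only [Finset.mem_insert, not_or] using hi
      rcases hout i hiS with hc | ⟨j, hj, hji⟩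
      · by_cases hd : Disjoint (tSubsets t (σ i)) (tSubsets t (σ ((candidates t σ S).min' h)))
        · refine Or.inl (mem_candidates.2 ⟨hi, fun j hj => ?_⟩)
          rcases Finset.mem_insert.1 hj with rfl | hj
          · exact hd
          · exact (mem_candidates.1 hc).2 j hj
        · exact Or.inr ⟨_, Finset.mem_insert_self _ _,
            lt_of_le_of_ne (Finset.min'_le _ _ hc) him.symm, hd⟩
      · exact Or.inr ⟨j, Finset.mem_insert_of_mem hj, hji⟩
  | case2 S h =>
    rw [greedyLoop, dif_neg h]
    intro i
    refine ⟨fun hi j hj hji => hdisj i hi j hj hji.ne, fun H => ?_⟩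
    by_contra hi
    rcases hout i hi with hc | ⟨j, hj, hji, hd⟩
    · exact h ⟨i, hc⟩
    · exact hd (H j hj hji)

lemma isGreedy_greedyPacking (t : ℕ) (σ : Ordering v k) :
    IsGreedy (tSubsets t) σ (greedyPacking t σ) :=
  isGreedy_greedyLoop t σ ∅ (by simp) fun i _ => Or.inl (mem_candidates.2 (by simp))

lemma mem_remaining {t : ℕ} {σ : Ordering v k} {T : Finset (Fin v)} :
    T ∈ remaining t σ ↔ T.card = t ∧ ¬ Covered σ (greedyPacking t σ) T := by
  simp [remaining]

lemma survives_of_mem_remaining {t : ℕ} {σ : Ordering v k}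
    {T : {T : Finset (Fin v) // T.card = t}} (hT : T.1 ∈ remaining t σ) (r : ℕ) :
    Survives (tSubsets t) σ (greedyPacking t σ) r {T} := by
  intro j hj _
  rw [Finset.disjoint_singleton_left, mem_tSubsets]
  exact fun h => (mem_remaining.1 hT).2 ⟨j, hj, h⟩

/-- Each block of the packing covers `k.choose t` of the `t`-sets, and no `t`-set is covered
twice. -/
lemma card_remaining_add (t : ℕ) (σ : Ordering v k) :
    (remaining t σ).card + (greedyPacking t σ).card * k.choose t = v.choose t := by
  classical
  have hM := isGreedy_greedyPacking t σ
  have hcov : ((Finset.univ : Finset (Fin v)).powersetCard t).filter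
      (fun T => Covered σ (greedyPacking t σ) T) =
      (greedyPacking t σ).biUnion fun i => (σ i).1.powersetCard t := by
    ext T
    simp only [Covered, Finset.mem_filter, Finset.mem_powersetCard, Finset.mem_biUnion,
      Finset.subset_univ, true_and]
    grind
  have hcard : ((greedyPacking t σ).biUnion fun i => (σ i).1.powersetCard t).card =
      (greedyPacking t σ).card * k.choose t := by
    rw [Finset.card_biUnion, Finset.sum_const_nat]
    · intro i _
      rw [Finset.card_powersetCard, (σ i).2]
    · intro i hi j hj hij
      refine disjoint_tSubsets.1 ?_
      rcases lt_or_gt_of_ne hij with h | h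
      · exact ((hM j).1 hj i hi h).symm
      · exact (hM i).1 hi j hj h
  rw [← hcard, ← hcov, add_comm, remaining, Finset.card_filter_add_card_filter_not,
    Finset.card_powersetCard, Finset.card_univ, Fintype.card_fin]

lemma isCovering_greedyCovering {t : ℕ} {σ : Ordering v k} {c : Finset (Fin v) → Finset (Fin v)}
    (hc : IsCoverRule t σ c) : IsCovering k t (greedyCovering t σ c) := by
  constructor
  · intro K hK
    rcases Multiset.mem_add.1 hK with hK | hK
    · obtain ⟨i, _, rfl⟩ := Multiset.mem_map.1 hK
      exact (σ i).2
    · obtain ⟨T, hT, rfl⟩ := Multiset.mem_map.1 hK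
      exact (hc T hT).1
  · intro T hT
    by_cases h : Covered σ (greedyPacking t σ) T
    · obtain ⟨j, hj, hTj⟩ := h
      exact ⟨_, Multiset.mem_add.2 (Or.inl (Multiset.mem_map_of_mem _ hj)), hTj⟩
    · have hr : T ∈ remaining t σ := mem_remaining.2 ⟨hT, h⟩
      exact ⟨_, Multiset.mem_add.2 (Or.inr (Multiset.mem_map_of_mem _ hr)), (hc T hr).2⟩

lemma density_eq {t : ℕ} {B : Multiset (Finset (Fin v))} (hB : ∀ K ∈ B, K.card = k) :
    density t B = B.card * k.choose t / v.choose t := by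
  rw [density]
  congr 1
  induction B using Multiset.induction with
  | empty => simp
  | cons K B ih =>
    have hK : (((Finset.univ : Finset (Fin v)).powersetCard t).filter fun T => T ⊆ K) =
        K.powersetCard t := by
      ext T
      simp [Finset.mem_powersetCard, and_comm]
    simp only [Multiset.countP_cons, Nat.cast_add, Finset.sum_add_distrib, Multiset.card_cons]
    rw [ih fun L hL => hB L (Multiset.mem_cons_of_mem hL)]
    push_cast
    rw [Finset.sum_boole, hK, Finset.card_powersetCard, hB K (Multiset.mem_cons_self K B)]
    ring

lemma one_le_density {t : ℕ} (htv : t ≤ v) {B : Multiset (Finset (Fin v))}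
    (hB : IsCovering k t B) : 1 ≤ density t B := by
  have hpos : (0 : ℝ) < v.choose t := by exact_mod_cast Nat.choose_pos htv
  rw [density, le_div_iff₀ hpos, one_mul]
  calc (v.choose t : ℝ) = ∑ T ∈ (Finset.univ : Finset (Fin v)).powersetCard t, (1 : ℝ) := by simp
    _ ≤ _ := Finset.sum_le_sum fun T hT => by
        obtain ⟨K, hK, hTK⟩ := hB.2 T (Finset.mem_powersetCard.1 hT).2
        exact_mod_cast Multiset.countP_pos.2 ⟨K, hK, hTK⟩

lemma density_dedup_le (t : ℕ) (B : Multiset (Finset (Fin v))) :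
    density t B.dedup ≤ density t B := by
  unfold density
  gcongr
  exact Multiset.dedup_le B

/-- Each remaining `t`-set costs one block, which covers `k.choose t` of the `t`-sets and so wastes
`k.choose t - 1` of them. -/
lemma density_greedyCovering {t : ℕ} (htv : t ≤ v) {σ : Ordering v k}
    {c : Finset (Fin v) → Finset (Fin v)} (hc : IsCoverRule t σ c) :
    density t (greedyCovering t σ c) =
      1 + ((k.choose t : ℝ) - 1) * ((remaining t σ).card / v.choose t) := by
  have hpos : (0 : ℝ) < v.choose t := by exact_mod_cast Nat.choose_pos htv
  have h := card_remaining_add t σ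
  rw [density_eq (isCovering_greedyCovering hc).1]
  have hcard : (greedyCovering t σ c).card = (greedyPacking t σ).card + (remaining t σ).card := by
    simp [greedyCovering]
  rw [hcard]
  have h' : ((remaining t σ).card : ℝ) + (greedyPacking t σ).card * k.choose t = v.choose t := by
    exact_mod_cast h
  field_simp
  push_cast
  linarith

lemma expect_card_remaining_le {t r : ℕ} {ε : ℝ} (htv : t ≤ v)
    (h : ∀ T, survivalProb (tSubsets t) (fun σ : Ordering v k => greedyPacking t σ) r {T} ≤ ε) :
    𝔼 σ : Ordering v k, ((remaining t σ).card : ℝ) / v.choose t ≤ ε := by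
  classical
  have hpos : (0 : ℝ) < v.choose t := by exact_mod_cast Nat.choose_pos htv
  have hcard : Fintype.card {T : Finset (Fin v) // T.card = t} = v.choose t := by
    simp
  have hle : ∀ σ : Ordering v k, ((remaining t σ).card : ℝ) ≤
      ∑ T : {T : Finset (Fin v) // T.card = t},
        if Survives (tSubsets t) σ (greedyPacking t σ) r {T} then (1 : ℝ) else 0 := by
    intro σ
    rw [Finset.sum_boole]
    norm_cast
    rw [← Finset.card_map (Function.Embedding.subtype _)]
    refine Finset.card_le_card fun T hT => ?_
    rw [Finset.mem_map]
    exact ⟨⟨T, (mem_remaining.1 hT).1⟩, by simpa using survives_of_mem_remaining hT r, rfl⟩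
  rw [← Finset.expect_div, div_le_iff₀ hpos]
  calc _ ≤ 𝔼 σ : Ordering v k, ∑ T : {T : Finset (Fin v) // T.card = t},
        (if Survives (tSubsets t) σ (greedyPacking t σ) r {T} then (1 : ℝ) else 0) :=
        Finset.expect_le_expect fun σ _ => hle σ
    _ = ∑ T : {T : Finset (Fin v) // T.card = t},
        survivalProb (tSubsets t) (fun σ : Ordering v k => greedyPacking t σ) r {T} :=
        Finset.expect_sum_comm _ _ _
    _ ≤ ∑ T : {T : Finset (Fin v) // T.card = t}, ε := Finset.sum_le_sum fun T _ => h T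
    _ = ε * v.choose t := by rw [Finset.sum_const, Finset.card_univ, hcard, nsmul_eq_mul, mul_comm]

lemma card_kSet_filter_superset (U : Finset (Fin v)) (hU : U.card ≤ k) :
    (Finset.univ.filter fun K : KSet v k => U ⊆ K.1).card =
      (v - U.card).choose (k - U.card) := by
  have hc : (v - U.card).choose (k - U.card) = (Uᶜ.powersetCard (k - U.card)).card := by
    rw [Finset.card_powersetCard, Finset.card_compl, Fintype.card_fin]
  rw [hc]
  refine Finset.card_bij' (fun K _ => K.1 \ U) (fun W hW => ⟨W ∪ U, ?_⟩) ?_ ?_ ?_ ?_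
  · rw [Finset.mem_powersetCard] at hW
    rw [Finset.card_union_of_disjoint
      (Finset.disjoint_of_subset_left hW.1 (disjoint_compl_left)), hW.2]
    lia
  · intro K hK
    rw [Finset.mem_filter] at hK
    rw [Finset.mem_powersetCard, Finset.card_sdiff_of_subset hK.2, K.2]
    refine ⟨fun x hx => ?_, rfl⟩
    rw [Finset.mem_compl]
    exact (Finset.mem_sdiff.1 hx).2
  · intro W hW
    simp
  · intro K hK
    rw [Finset.mem_filter] at hK
    exact Subtype.ext (Finset.sdiff_union_of_subset hK.2)
  · intro W hW
    rw [Finset.mem_powersetCard] at hW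
    exact Finset.union_sdiff_cancel_right
      (Finset.disjoint_of_subset_left hW.1 (disjoint_compl_left))

lemma degree_tSubsets {t : ℕ} (htk : t ≤ k) (T : {T : Finset (Fin v) // T.card = t}) :
    (Finset.univ.filter fun K : KSet v k => T ∈ tSubsets t K).card = (v - t).choose (k - t) := by
  simp only [mem_tSubsets]
  rw [card_kSet_filter_superset _ (T.2.trans_le htk), T.2]

lemma codegree_tSubsets_le {t : ℕ} (htk : t < k) {T T' : {T : Finset (Fin v) // T.card = t}}
    (hT : T ≠ T') :
    (Finset.univ.filter fun K : KSet v k => T ∈ tSubsets t K ∧ T' ∈ tSubsets t K).card ≤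
      (v - (t + 1)).choose (k - (t + 1)) := by
  have hlt : t + 1 ≤ (T.1 ∪ T'.1).card := by
    by_contra! h
    have h1 : T.1 = T.1 ∪ T'.1 :=
      Finset.eq_of_subset_of_card_le Finset.subset_union_left (by rw [T.2]; lia)
    have h2 : T'.1 = T.1 ∪ T'.1 :=
      Finset.eq_of_subset_of_card_le Finset.subset_union_right (by rw [T'.2]; lia)
    exact hT (Subtype.ext (h1.trans h2.symm))
  obtain ⟨U, hU, hUc⟩ := Finset.exists_subset_card_eq hlt
  rw [← hUc, ← card_kSet_filter_superset U (by lia)]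
  refine Finset.card_le_card fun K hK => ?_
  simp only [Finset.mem_filter, Finset.mem_univ, true_and, mem_tSubsets] at hK ⊢
  exact hU.trans (Finset.union_subset hK.1 hK.2)

end Packing

lemma tendsto_expect_card_remaining {k t : ℕ} (ht : 0 < t) (htk : t < k) :
    Tendsto (fun v : ℕ => 𝔼 σ : Ordering v k, ((remaining t σ).card : ℝ) / v.choose t)
      atTop (𝓝 0) := by
  rw [Metric.tendsto_atTop']
  intro ε hε
  obtain ⟨δ, hδ, H⟩ := exists_survivalProb_le (k.choose t - 1) (half_pos hε)
  obtain ⟨N, hN⟩ := exists_nat_ge ((k + t * k.choose t) / δ + t + k)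
  refine ⟨N, fun v hv => ?_⟩
  have hvN : (N : ℝ) ≤ v := by exact_mod_cast hv.le
  have hfrac : 0 ≤ (k + t * k.choose t : ℝ) / δ := by positivity
  have ht0 : (0 : ℝ) ≤ t := Nat.cast_nonneg t
  have hkv : k ≤ v := by
    have : (k : ℝ) ≤ v := by linarith
    exact_mod_cast this
  have hbig : (k + t * k.choose t : ℝ) ≤ δ * (v - t) := by
    rw [mul_comm δ, ← div_le_iff₀ hδ]
    have : (0 : ℝ) ≤ k := Nat.cast_nonneg k
    linarith
  have hQ0 : 0 < k.choose t := Nat.choose_pos htk.le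
  have htQ : (0 : ℝ) ≤ t * k.choose t := by positivity
  -- `C` bounds the codegrees, and `C / D = (k - t) / (v - t)`
  set D : ℕ := (v - t).choose (k - t) with hD
  set C : ℕ := (v - (t + 1)).choose (k - (t + 1)) with hC
  have hC1 : 1 ≤ C := Nat.choose_pos (by lia)
  have hCD : (C : ℝ) ≤ δ * D := by
    have h1 : (v - t) * C = D * (k - t) := by
      have := Nat.add_one_mul_choose_eq (v - (t + 1)) (k - (t + 1))
      rwa [show v - (t + 1) + 1 = v - t by lia, show k - (t + 1) + 1 = k - t by lia] at this
    have h2 : ((v : ℝ) - t) * C = D * (k - t) := by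
      rw [← Nat.cast_sub (htk.le.trans hkv), ← Nat.cast_sub htk.le]
      exact_mod_cast h1
    have hvt : (0 : ℝ) < v - t := sub_pos.2 (by exact_mod_cast htk.trans_le hkv)
    have h3 : (k : ℝ) - t ≤ δ * (v - t) := by linarith
    refine le_of_mul_le_mul_left ?_ hvt
    rw [h2]
    calc (D : ℝ) * (k - t) ≤ D * (δ * (v - t)) := by gcongr
      _ = _ := by ring
  have hDn : (D : ℝ) ≤ δ * (v.choose k : ℕ) := by
    -- double counting gives `D / v.choose k = k.choose t / v.choose t`, and `v ≤ t * v.choose t`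
    have h1 : v.choose k * k.choose t = v.choose t * D := Nat.choose_mul htk.le
    have h2 : v * (v - 1).choose (t - 1) = v.choose t * t := by
      have := Nat.add_one_mul_choose_eq (v - 1) (t - 1)
      rwa [show v - 1 + 1 = v by lia, show t - 1 + 1 = t by lia] at this
    have h3 : v ≤ v.choose t * t := by
      rw [← h2]
      exact Nat.le_mul_of_pos_right _ (Nat.choose_pos (by lia))
    have h3' : (v : ℝ) ≤ v.choose t * t := by exact_mod_cast h3
    have h1' : (v.choose k : ℝ) * k.choose t = v.choose t * D := by exact_mod_cast h1
    have ht' : (0 : ℝ) < t := by exact_mod_cast ht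
    have hk0 : (0 : ℝ) ≤ k := Nat.cast_nonneg k
    have hQ : (k.choose t : ℝ) ≤ δ * v.choose t := by
      refine le_of_mul_le_mul_left ?_ ht'
      nlinarith
    have hQ' : (0 : ℝ) < k.choose t := by exact_mod_cast hQ0
    refine le_of_mul_le_mul_right ?_ hQ'
    calc (D : ℝ) * k.choose t ≤ D * (δ * v.choose t) := by gcongr
      _ = δ * (v.choose k * k.choose t) := by rw [h1']; ring
      _ = _ := by ring
  have hne : Nonempty (Ordering v k) := ⟨(Fintype.equivFinOfCardEq (by simp)).symm⟩
  obtain ⟨r, hr⟩ := H _ (KSet v k) (v.choose k) D (tSubsets t) (fun σ => greedyPacking t σ)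
    hne (isGreedy_greedyPacking t) (fun K => by rw [card_tSubsets]; lia)
    (degree_tSubsets htk.le)
    (fun T T' h => le_trans (by exact_mod_cast codegree_tSubsets_le htk h) hCD)
    (le_trans (by exact_mod_cast hC1) hCD) hDn
  rw [Real.dist_eq, sub_zero, abs_of_nonneg (Finset.expect_nonneg fun σ _ => by positivity)]
  exact (expect_card_remaining_le (htk.le.trans hkv) hr).trans_lt (half_lt_self hε)

end Covering

theorem theoremt (k t : ℕ) (htk : t ≤ k)
    (c : ∀ v : ℕ, Covering.Ordering v k → Finset (Fin v) → Finset (Fin v))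
    (hc : ∀ v : ℕ, k ≤ v → ∀ σ : Covering.Ordering v k, Covering.IsCoverRule t σ (c v σ)) :
    (∀ v : ℕ, k ≤ v → ∀ σ : Covering.Ordering v k,
      Covering.IsCovering k t (Covering.greedyCovering t σ (c v σ))) ∧
    Tendsto (fun v : ℕ => 𝔼 σ : Covering.Ordering v k,
      Covering.density t (Covering.greedyCovering t σ (c v σ))) atTop (𝓝 1) ∧
    Tendsto (fun v : ℕ => 𝔼 σ : Covering.Ordering v k,
      Covering.density t (Covering.greedyCovering t σ (c v σ)).dedup) atTop (𝓝 1) := by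
  have hcov : ∀ v : ℕ, k ≤ v → ∀ σ : Covering.Ordering v k,
      Covering.IsCovering k t (Covering.greedyCovering t σ (c v σ)) :=
    fun v hv σ => Covering.isCovering_greedyCovering (hc v hv σ)
  have hne : ∀ v, Nonempty (Covering.Ordering v k) := fun v =>
    ⟨(Fintype.equivFinOfCardEq (by simp)).symm⟩
  have hexp : ∀ v : ℕ, k ≤ v → 𝔼 σ : Covering.Ordering v k,
      Covering.density t (Covering.greedyCovering t σ (c v σ)) =
      1 + ((k.choose t : ℝ) - 1) *
        𝔼 σ : Covering.Ordering v k, ((Covering.remaining t σ).card : ℝ) / v.choose t := by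
    intro v hv
    have := hne v
    rw [Finset.mul_expect, Finset.expect_congr rfl fun σ _ =>
      Covering.density_greedyCovering (htk.trans hv) (hc v hv σ), Finset.expect_add_distrib,
      Fintype.expect_const]
  have hlim : Tendsto (fun v : ℕ => 1 + ((k.choose t : ℝ) - 1) *
      𝔼 σ : Covering.Ordering v k, ((Covering.remaining t σ).card : ℝ) / v.choose t)
      atTop (𝓝 1) := by
    -- if `t = 0` or `t = k`, the factor in front of the expectation vanishes
    by_cases hQ : k.choose t = 1
    · simp [hQ]
    · have ht : 0 < t := Nat.pos_of_ne_zero fun h => hQ (by simp [h])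
      have htk' : t < k := lt_of_le_of_ne htk fun h => hQ (by simp [h])
      simpa using ((Covering.tendsto_expect_card_remaining ht htk').const_mul
        ((k.choose t : ℝ) - 1)).const_add 1
  have htend : Tendsto (fun v : ℕ => 𝔼 σ : Covering.Ordering v k,
      Covering.density t (Covering.greedyCovering t σ (c v σ))) atTop (𝓝 1) :=
    hlim.congr' ((eventually_ge_atTop k).mono fun v hv => (hexp v hv).symm)
  refine ⟨hcov, htend, ?_⟩
  refine tendsto_of_tendsto_of_tendsto_of_le_of_le' tendsto_const_nhds htend ?_ ?_
  · filter_upwards [eventually_ge_atTop k] with v hv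
    have := hne v
    refine Finset.le_expect Finset.univ_nonempty fun σ _ => ?_
    exact Covering.one_le_density (k := k) (htk.trans hv)
      ⟨fun K hK => (hcov v hv σ).1 K (Multiset.mem_dedup.1 hK), fun T hT => by
        simpa only [Multiset.mem_dedup] using (hcov v hv σ).2 T hT⟩
  · exact Eventually.of_forall fun v =>
      Finset.expect_le_expect fun σ _ => Covering.density_dedup_le t _
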